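/- Let $A\in\mathbb R^{n\times n}$, $B\in\mathbb R^{n\times m}$, $C\in\mathbb R^{k\times n}$, $D\in\mathbb R^{k\times m}$, let $G(s)=C(sI-A)^{-1}B+D$ (so $G(\infty)=D$), and let $P\in\mathbb R^{(k+m)\times(k+m)}$ be symmetric. A signal is a function on $[0,\infty)$ that is right-continuous and piecewise continuous (finitely many discontinuities on each bounded interval, with one-sided limits). For a (possibly multivalued) static nonlinearity $\varphi$ from $\mathbb R^k$ to $\mathbb R^m$ and $x_0\in\mathbb R^n$, a response of the feedback loop $$\dot x=Ax+Bw,\qquad z=Cx+Dw,\qquad w=\varphi(z),\qquad x(0)=x_0 \tag{1}$$ is a triple $(x,w,z)$ where $w,z$ are signals, $x$ is continuous on $[0,\infty)$ with a right derivative $\dot x(t)$ at each $t\ge0$, $\dot x$ is a signal, and (1) holds for all $t\ge 0$ (for multivalued $\varphi$, $w=\varphi(z)$ means $w(t)\in\varphi(z(t))$). Neither existence nor uniqueness of responses is assumed. The loop (1) is called ($L_2$-)stable if there is $\gamma>0$ such that, for all $x_0\in\mathbb R^n$, all responses satisfy $$\int_0^T\|x(t)\|^2\,dt+\int_0^T\|w(t)\|^2\,dt\le\gamma^2\|x_0\|^2\quad\text{for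 all }T\ge0 .$$ Theorem (circle criterion). Suppose that $A$ has no eigenvalues in $i\mathbb R$, and that there is some $\Delta_0\in\mathbb R^{m\times k}$ with $$\begin{pmatrix}I\\\Delta_0\end{pmatrix}^{T}P\begin{pmatrix}I\\\Delta_0\end{pmatrix}\succeq0$$ such that all responses of (1) for $\varphi(z)=\Delta_0z$ (and all $x_0$) satisfy $\lim_{t\to\infty}x(t)=0$. If $$\begin{pmatrix}G(i\omega)\\I\end{pmatrix}^{*}P\begin{pmatrix}G(i\omega)\\I\end{pmatrix}\prec0\quad\text{for all }\omega\in\mathbb R\cup\{\infty\},$$ then (1) is stable for every nonlinearity $\varphi$ from $\mathbb R^k$ to $\mathbb R^m$ with $$\begin{pmatrix}z\\\varphi(z)\end{pmatrix}^{T}P\begin{pmatrix}z\\\varphi(z)\end{pmatrix}\ge0\quad\text{for all }z\in\mathbb R^k$$ (for multivalued $\varphi$: for all $z$ and all values of $\varphi$ at $z$). -/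

import Mathlib

open Set Filter Topology
open scoped ComplexOrder

noncomputable section

namespace CircleCriterion

/-- `ℝⁿ` with the Euclidean norm. -/
abbrev Vec (n : ℕ) : Type := EuclideanSpace ℝ (Fin n)

/-- The data of a linear system `x' = A x + B u`, `y = C x + D u` with `x(t) ∈ ℝⁿ`, `u(t) ∈ ℝᵐ`,
`y(t) ∈ ℝᵏ`. -/
structure LinSys (n m k : ℕ) where
  A : Matrix (Fin n) (Fin n) ℝ
  B : Matrix (Fin n) (Fin m) ℝ
  C : Matrix (Fin k) (Fin n) ℝ
  D : Matrix (Fin k) (Fin m) ℝ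

/-- A real matrix viewed as a complex matrix. -/
def toC {ι κ : Type*} (M : Matrix ι κ ℝ) : Matrix ι κ ℂ := M.map Complex.ofReal

/-- The transfer matrix `G(s) = C (sI - A)⁻¹ B + D`. -/
def LinSys.transfer {n m k : ℕ} (S : LinSys n m k) (s : ℂ) : Matrix (Fin k) (Fin m) ℂ :=
  toC S.C * (s • (1 : Matrix (Fin n) (Fin n) ℂ) - toC S.A)⁻¹ * toC S.B + toC S.D

/-- The frequency response `ω ↦ G(iω)` on `ℝ ∪ {∞}`; the value at infinity of the proper
transfer matrix `G` is `D`. -/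
def LinSys.freqResponse {n m k : ℕ} (S : LinSys n m k) : OnePoint ℝ → Matrix (Fin k) (Fin m) ℂ
  | .infty => toC S.D
  | .some ω => S.transfer (Complex.I * (ω : ℂ))

/-- `A` has no eigenvalues on the imaginary axis. -/
def LinSys.NoImaginaryEigenvalue {n m k : ℕ} (S : LinSys n m k) : Prop :=
  ∀ ω : ℝ, ¬ Module.End.HasEigenvalue (Matrix.toLin' (toC S.A)) (Complex.I * (ω : ℂ))

/-- `s_P(U, Y) = [Y; U]* P [Y; U]` for matrices `U`, `Y` with `p` columns (over `ℝ`, conjugate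
transposition is transposition). -/
def quadMatrix {𝕜 : Type*} [RCLike 𝕜] {k m p : ℕ} (P : Matrix (Fin k ⊕ Fin m) (Fin k ⊕ Fin m) 𝕜)
    (U : Matrix (Fin m) (Fin p) 𝕜) (Y : Matrix (Fin k) (Fin p) 𝕜) : Matrix (Fin p) (Fin p) 𝕜 :=
  (Matrix.fromRows Y U).conjTranspose * P * Matrix.fromRows Y U

/-- `s_P(w, z) = [z; w]ᵀ P [z; w]` for vectors. -/
def quadVec {k m : ℕ} (P : Matrix (Fin k ⊕ Fin m) (Fin k ⊕ Fin m) ℝ) (w : Vec m) (z : Vec k) : ℝ :=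
  Sum.elim z.ofLp w.ofLp ⬝ᵥ P.mulVec (Sum.elim z.ofLp w.ofLp)

/-- A possibly multivalued static nonlinearity: `φ z` is the set of values at `z`. A
single-valued map `f` is `fun z => {f z}`. -/
abbrev Nonlinearity (k m : ℕ) : Type := Vec k → Set (Vec m)

/-- The linear map `z ↦ Δ z` as a nonlinearity. -/
def linearNonlinearity {k m : ℕ} (Δ : Matrix (Fin m) (Fin k) ℝ) : Nonlinearity k m :=
  fun z => {Matrix.toEuclideanLin Δ z}

/-- The quadratic constraint `[z; φ(z)]ᵀ P [z; φ(z)] ≥ 0` on the graph of `φ`. -/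
def QuadraticConstraint {k m : ℕ} (P : Matrix (Fin k ⊕ Fin m) (Fin k ⊕ Fin m) ℝ)
    (φ : Nonlinearity k m) : Prop :=
  ∀ z : Vec k, ∀ w ∈ φ z, 0 ≤ quadVec P w z

/-- The signal space: `u` restricted to `[0, ∞)` is right-continuous and piecewise continuous,
that is, it has finitely many discontinuities in each bounded interval, and left limits there.
Values at negative times play no role. -/
structure IsSignal {d : ℕ} (u : ℝ → Vec d) : Prop where
  rightCont : ∀ t, 0 ≤ t → ContinuousWithinAt u (Ici t) t
  leftLim : ∀ t, 0 < t → ∃ l : Vec d, Tendsto u (𝓝[<] t) (𝓝 l)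
  finite_discont : ∀ T : ℝ, {t : ℝ | t ∈ Ioc 0 T ∧ ¬ ContinuousAt u t}.Finite

/-- `x` is a state trajectory on `[0, ∞)` with right derivative `v`: `x` is continuous and `v` is
a signal. -/
structure IsStateTrajectory {d : ℕ} (x v : ℝ → Vec d) : Prop where
  cont : ContinuousOn x (Ici 0)
  signal_deriv : IsSignal v
  hasRightDeriv : ∀ t, 0 ≤ t → HasDerivWithinAt x (v t) (Ici t) t

/-- `(x, w, z)` is a response of the feedback loop
`x' = A x + B w`, `z = C x + D w`, `w = φ(z)`, `x(0) = x₀`. -/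
structure IsResponse {n m k : ℕ} (S : LinSys n m k) (φ : Nonlinearity k m) (x₀ : Vec n)
    (x : ℝ → Vec n) (w : ℝ → Vec m) (z : ℝ → Vec k) : Prop where
  signal_w : IsSignal w
  signal_z : IsSignal z
  dynamics : ∃ v : ℝ → Vec n, IsStateTrajectory x v ∧
    ∀ t, 0 ≤ t → v t = Matrix.toEuclideanLin S.A (x t) + Matrix.toEuclideanLin S.B (w t)
  output : ∀ t, 0 ≤ t → z t = Matrix.toEuclideanLin S.C (x t) + Matrix.toEuclideanLin S.D (w t)
  feedback : ∀ t, 0 ≤ t → w t ∈ φ (z t)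
  init : x 0 = x₀

/-- `L₂`-stability of the feedback loop. -/
def LoopStable {n m k : ℕ} (S : LinSys n m k) (φ : Nonlinearity k m) : Prop :=
  ∃ γ : ℝ, 0 < γ ∧ ∀ (x₀ : Vec n) (x : ℝ → Vec n) (w : ℝ → Vec m) (z : ℝ → Vec k),
    IsResponse S φ x₀ x w z → ∀ T : ℝ, 0 ≤ T →
      (∫ t in (0 : ℝ)..T, ‖x t‖ ^ 2) + (∫ t in (0 : ℝ)..T, ‖w t‖ ^ 2) ≤ γ ^ 2 * ‖x₀‖ ^ 2

/-- All trajectories of the feedback loop satisfy `x(t) → 0` as `t → ∞`. -/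
def LoopAttractive {n m k : ℕ} (S : LinSys n m k) (φ : Nonlinearity k m) : Prop :=
  ∀ (x₀ : Vec n) (x : ℝ → Vec n) (w : ℝ → Vec m) (z : ℝ → Vec k),
    IsResponse S φ x₀ x w z → Tendsto x atTop (𝓝 0)

/-- The strict frequency-domain inequality `[G(iω); I]* P [G(iω); I] ≺ 0` on `ℝ ∪ {∞}`. -/
def StrictFDI {n m k : ℕ} (S : LinSys n m k)
    (P : Matrix (Fin k ⊕ Fin m) (Fin k ⊕ Fin m) ℝ) : Prop :=
  ∀ ω : OnePoint ℝ, (-(quadMatrix (toC P) 1 (S.freqResponse ω))).PosDef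

end CircleCriterion

end

/-! The frequency inequality yields a quadratic storage function V(x) = g(x xᵀ) with dV/dt + s_P(w,
z) ≤ -ε(‖x‖² + ‖w‖²) along the linear system (`StrictFDI.exists_storage`). Where the feedback forces
s_P ≥ 0, integration gives V(x(T)) + ε∫(‖x‖² + ‖w‖²) ≤ V(x₀) (`IsResponse.integral_le`), which is
stability as soon as V ≥ 0.

Since A need not be Hurwitz, the storage inequality alone gives V no sign. The nominal gain supplies
it: Δ₀ obeys the same constraint, so V(x(T)) ≤ V(x₀) on nominal responses, and x(T) → 0 forces V(x₀)
≥ 0. Attractivity would be vacuous without responses, so they are constructed, which needs I - Δ₀D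
invertible (`isUnit_det_of_quadVec_neg`).

The storage function comes from convex separation. With L = (A B), E = (I 0), the obstruction is a
nonzero W ⪰ 0 with L W Eᵀ + E W Lᵀ = 0 and tr(QW) ≥ 0. The equation splits W into complex rank-one
terms v v* with Ev = 0 or Lv = iωEv, and on such v ≠ 0 the frequency inequality makes the form
negative (`trace_neg_of_mul_transpose_add`). -/

namespace CircleCriterion

open Matrix MeasureTheory

/-! ### Rank-one decomposition adapted to the imaginary axis -/

open scoped InnerProductSpace in
/-- If `X Y* + Y X* = 0`, then there is an orthonormal basis each of whose members `b` satisfies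
`X b = 0` or `Y b = iω X b` for a real `ω`. -/
theorem exists_orthonormalBasis_of_comp_adjoint_add {T V : Type*}
    [NormedAddCommGroup T] [InnerProductSpace ℂ T] [FiniteDimensional ℂ T]
    [NormedAddCommGroup V] [InnerProductSpace ℂ V] [FiniteDimensional ℂ V]
    (X Y : T →ₗ[ℂ] V)
    (h : ∀ a, X (LinearMap.adjoint Y a) + Y (LinearMap.adjoint X a) = 0) :
    ∃ (κ : Type) (_ : Fintype κ) (b : OrthonormalBasis κ ℂ T),
      ∀ j, X (b j) = 0 ∨ ∃ ω : ℝ, Y (b j) = (Complex.I * (ω : ℂ)) • X (b j) := by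
  set K : Submodule ℂ T := X.kerᗮ with hK
  have hmem : ∀ q ∈ K, ∃ a, LinearMap.adjoint X a = q := by
    intro q hq
    rw [hK, LinearMap.orthogonal_ker] at hq
    exact hq
  have hinj : LinearMap.ker (X.domRestrict K) = ⊥ := by
    rw [LinearMap.ker_eq_bot']
    rintro ⟨q, hq⟩ hXq
    have h1 : q ∈ X.ker := hXq
    have h2 := Submodule.inner_right_of_mem_orthogonal h1 hq
    exact Subtype.ext (inner_self_eq_zero.1 h2)
  obtain ⟨g, hg⟩ := LinearMap.exists_leftInverse_of_injective _ hinj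
  have hproj : ∀ r : T, X (K.orthogonalProjectionOnto r : T) = X r := by
    intro r
    have h1 : r - K.orthogonalProjectionOnto r ∈ Kᗮ := K.sub_starProjection_mem_orthogonal r
    have h3 : Kᗮ = X.ker := by rw [hK, Submodule.orthogonal_orthogonal]
    rw [h3] at h1
    have h2 : X (r - K.orthogonalProjectionOnto r) = 0 := h1
    rw [map_sub, sub_eq_zero] at h2
    exact h2.symm
  -- `J` is the quotient "X⁻¹Y" on K = (ker X)ᗮ = range X*. It is well behaved because Y X* = -X Y*
  -- puts Y(K) inside the range of X.
  let J : K →ₗ[ℂ] K := g ∘ₗ Y ∘ₗ K.subtype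
  have hJ : ∀ q : K, X (J q : T) = Y q := by
    rintro ⟨q, hq⟩
    obtain ⟨a, rfl⟩ := hmem q hq
    have h1 : Y (LinearMap.adjoint X a) =
        X.domRestrict K (-K.orthogonalProjectionOnto (LinearMap.adjoint Y a)) := by
      rw [map_neg, LinearMap.domRestrict_apply, hproj]
      exact eq_neg_of_add_eq_zero_right (h a)
    have h2 : J ⟨_, hq⟩ = -K.orthogonalProjectionOnto (LinearMap.adjoint Y a) := by
      change g (Y (LinearMap.adjoint X a)) = _
      rw [h1]
      exact LinearMap.congr_fun hg _
    rw [h2, h1]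
    rfl
  have hskew : ∀ q r : K, ⟪J q, r⟫_ℂ + ⟪q, J r⟫_ℂ = 0 := by
    rintro ⟨q, hq⟩ ⟨r, hr⟩
    obtain ⟨a, rfl⟩ := hmem q hq
    obtain ⟨c, rfl⟩ := hmem r hr
    rw [Submodule.coe_inner, Submodule.coe_inner]
    simp only [LinearMap.adjoint_inner_right, LinearMap.adjoint_inner_left, hJ]
    rw [← LinearMap.adjoint_inner_right Y, LinearMap.adjoint_inner_left X, ← inner_add_right,
      h, inner_zero_right]
  -- `J` is skew-adjoint, so -i`J` has a real spectrum ω and an orthonormal eigenbasis of K; ker X =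
  -- Kᗮ accepts any orthonormal basis.
  let H : K →ₗ[ℂ] K := (-Complex.I) • J
  have hH : H.IsSymmetric := by
    intro q r
    have := hskew q r
    simp only [H, LinearMap.smul_apply, inner_smul_left, inner_smul_right, map_neg, Complex.conj_I]
    linear_combination Complex.I * this
  let e := (hH.eigenvectorBasis rfl).prod (stdOrthonormalBasis ℂ Kᗮ)
  refine ⟨_, inferInstance, e.map (Submodule.orthogonalDecomposition K).symm, ?_⟩
  rintro (j | j)
  · right
    refine ⟨hH.eigenvalues rfl j, ?_⟩
    have h1 := hH.apply_eigenvectorBasis rfl j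
    have h2 : J (hH.eigenvectorBasis rfl j) =
        (Complex.I * (hH.eigenvalues rfl j : ℂ)) • hH.eigenvectorBasis rfl j := by
      rw [mul_smul]
      change _ = Complex.I • ((hH.eigenvalues rfl j : ℂ) • hH.eigenvectorBasis rfl j)
      erw [← h1]
      simp [H, smul_smul]
    have h3 := hJ (hH.eigenvectorBasis rfl j)
    rw [h2, Submodule.coe_smul, map_smul] at h3
    simpa [e] using h3.symm
  · left
    have h2 : Kᗮ = X.ker := by rw [hK, Submodule.orthogonal_orthogonal]
    have h1 : ((stdOrthonormalBasis ℂ Kᗮ j : Kᗮ) : T) ∈ X.ker :=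
      h2.le (stdOrthonormalBasis ℂ Kᗮ j).2
    simpa [e] using h1

/-! ### Negativity of the trace, via complexification -/

theorem toC_mul {α β γ : Type*} [Fintype β] (M : Matrix α β ℝ) (N : Matrix β γ ℝ) :
    toC (M * N) = toC M * toC N :=
  Matrix.map_mul (f := Complex.ofRealHom)

theorem toC_transpose {α β : Type*} (M : Matrix α β ℝ) : toC Mᵀ = (toC M)ᴴ := by
  ext i j
  simp [toC]

theorem toC_injective {α β : Type*} : Function.Injective (toC : Matrix α β ℝ → Matrix α β ℂ) :=
  Matrix.map_injective Complex.ofReal_injective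

/-- If a Hermitian form is negative on all `v ≠ 0` with `E v = 0` or `L v = iω E v`, then its trace
against `V Vᵀ` is negative whenever `V ≠ 0` and `(L V) (E V)ᵀ` is skew-symmetric. -/
theorem trace_neg_of_mul_transpose_add {α β ι : Type*} [Fintype α] [Fintype β] [Fintype ι]
    (L E : Matrix α β ℝ) (Q : Matrix β β ℝ)
    (hQ : ∀ v : β → ℂ, v ≠ 0 →
      (toC E *ᵥ v = 0 ∨ ∃ ω : ℝ, toC L *ᵥ v = (Complex.I * (ω : ℂ)) • toC E *ᵥ v) →
      (star v ⬝ᵥ toC Q *ᵥ v).re < 0)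
    (V : Matrix β ι ℝ) (hV : V ≠ 0)
    (h : (L * V) * (E * V)ᵀ + (E * V) * (L * V)ᵀ = 0) :
    trace (Vᵀ * Q * V) < 0 := by
  classical
  have hadj : ∀ a, toEuclideanLin (toC (E * V)) (LinearMap.adjoint (toEuclideanLin (toC (L * V))) a)
      + toEuclideanLin (toC (L * V)) (LinearMap.adjoint (toEuclideanLin (toC (E * V))) a) = 0 := by
    intro a
    rw [← toEuclideanLin_conjTranspose_eq_adjoint, ← toEuclideanLin_conjTranspose_eq_adjoint,
      ← toC_transpose, ← toC_transpose, ← LinearMap.comp_apply, ← LinearMap.comp_apply,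
      ← toLpLin_mul_same, ← toLpLin_mul_same, ← LinearMap.add_apply, ← map_add, ← toC_mul,
      ← toC_mul]
    have h0 : toC ((E * V) * (L * V)ᵀ) + toC ((L * V) * (E * V)ᵀ) = 0 := by
      have := congrArg toC h
      ext i j
      have := congrFun (congrFun this i) j
      simpa [toC, add_comm] using this
    rw [h0, map_zero, LinearMap.zero_apply]
  obtain ⟨κ, _, b, hb⟩ := exists_orthonormalBasis_of_comp_adjoint_add _ _ hadj
  have hform : ∀ q : EuclideanSpace ℂ ι,
      inner ℂ q (toEuclideanLin (toC (Vᵀ * Q * V)) q) =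
        star (toC V *ᵥ q.ofLp) ⬝ᵥ toC Q *ᵥ (toC V *ᵥ q.ofLp) := by
    intro q
    rw [EuclideanSpace.inner_eq_star_dotProduct, toC_mul, toC_mul, toC_transpose]
    simp only [toLpLin_apply, ← mulVec_mulVec]
    rw [dotProduct_comm, dotProduct_mulVec, star_mulVec]
  -- The trace may be computed in the adapted complex basis, where each summand is the form at one
  -- admissible vector V b.
  have htr : ((trace (Vᵀ * Q * V) : ℝ) : ℂ) =
      ∑ j, star (toC V *ᵥ (b j).ofLp) ⬝ᵥ toC Q *ᵥ (toC V *ᵥ (b j).ofLp) := by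
    have h1 : LinearMap.trace ℂ _ (toEuclideanLin (toC (Vᵀ * Q * V))) = trace (toC (Vᵀ * Q * V)) := by
      rw [toEuclideanLin, toLpLin_eq_toLin, trace_toLin_eq]
    simp_rw [← hform]
    rw [← LinearMap.trace_eq_sum_inner _ b, h1]
    simp [trace, toC]
  have hEL : ∀ (M : Matrix α β ℝ) (q : EuclideanSpace ℂ ι),
      toC M *ᵥ (toC V *ᵥ q.ofLp) = (toEuclideanLin (toC (M * V)) q).ofLp := by
    intro M q
    rw [toLpLin_apply, toC_mul, mulVec_mulVec]
  have hneg : ∀ j, toC V *ᵥ (b j).ofLp ≠ 0 →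
      (star (toC V *ᵥ (b j).ofLp) ⬝ᵥ toC Q *ᵥ (toC V *ᵥ (b j).ofLp)).re < 0 := by
    intro j hj
    refine hQ _ hj ?_
    rw [hEL, hEL]
    rcases hb j with h1 | ⟨ω, h1⟩
    · left; rw [h1]; rfl
    · right; exact ⟨ω, by rw [h1]; rfl⟩
  have hex : ∃ j, toC V *ᵥ (b j).ofLp ≠ 0 := by
    by_contra! hall
    have h1 : toEuclideanLin (toC V) = 0 := by
      refine b.toBasis.ext fun j => ?_
      rw [OrthonormalBasis.coe_toBasis, toLpLin_apply, hall j]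
      rfl
    have h2 : toC V = 0 := by simpa using h1
    apply hV
    apply toC_injective
    rw [h2]
    ext i j
    simp [toC]
  obtain ⟨j₀, hj₀⟩ := hex
  have hre := congrArg Complex.re htr
  rw [Complex.ofReal_re, Complex.re_sum] at hre
  rw [hre]
  refine Finset.sum_neg' (fun j _ => ?_) ⟨j₀, Finset.mem_univ _, hneg j₀ hj₀⟩
  by_cases hj : toC V *ᵥ (b j).ofLp = 0
  · simp [hj]
  · exact (hneg j hj).le

/-! ### The strict Kalman–Yakubovich–Popov lemma by separation -/

/-- The positive semidefinite matrices of trace one. -/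
def spectraplex (β : Type*) [Fintype β] : Set (Matrix β β ℝ) :=
  {W | W.PosSemidef ∧ W.trace = 1}

theorem convex_spectraplex (β : Type*) [Fintype β] : Convex ℝ (spectraplex β) := by
  rintro W ⟨hW, hW1⟩ Z ⟨hZ, hZ1⟩ a b ha hb hab
  refine ⟨(hW.smul ha).add (hZ.smul hb), ?_⟩
  rw [trace_add, trace_smul, trace_smul, hW1, hZ1, smul_eq_mul, smul_eq_mul, mul_one, mul_one, hab]

open scoped MatrixOrder in
theorem exists_transpose_mul_self_of_posSemidef {β : Type*} [Fintype β] {W : Matrix β β ℝ}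
    (hW : W.PosSemidef) : ∃ F : Matrix β β ℝ, W = Fᵀ * F := by
  classical
  exact CStarAlgebra.nonneg_iff_eq_star_mul_self.mp hW.nonneg

/-- Through W = FᵀF this set is the continuous image of the Frobenius unit sphere. -/
theorem isCompact_spectraplex (β : Type*) [Fintype β] : IsCompact (spectraplex β) := by
  have himage : spectraplex β = (fun F : Matrix β β ℝ => Fᵀ * F) '' {F | trace (Fᵀ * F) = 1} := by
    ext W
    constructor
    · rintro ⟨hW, hW1⟩
      obtain ⟨F, rfl⟩ := exists_transpose_mul_self_of_posSemidef hW
      exact ⟨F, hW1, rfl⟩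
    · rintro ⟨F, hF, rfl⟩
      exact ⟨posSemidef_conjTranspose_mul_self F, hF⟩
  rw [himage]
  have hcont : Continuous fun F : Matrix β β ℝ => Fᵀ * F := by fun_prop
  refine IsCompact.image ?_ hcont
  have hclosed : IsClosed {F : Matrix β β ℝ | trace (Fᵀ * F) = 1} :=
    isClosed_eq hcont.matrix_trace continuous_const
  refine IsCompact.of_isClosed_subset
    (isCompact_univ_pi fun _ : β => isCompact_univ_pi fun _ : β =>
      isCompact_Icc (a := (-1 : ℝ)) (b := 1))
    hclosed ?_
  intro F hF
  have hsum : ∑ j, ∑ i, F i j * F i j = 1 := by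
    simpa [trace, mul_apply] using hF
  intro i _ j _
  have h1 : F i j * F i j ≤ ∑ i, F i j * F i j :=
    Finset.single_le_sum (f := fun i => F i j * F i j) (fun _ _ => mul_self_nonneg _)
      (Finset.mem_univ i)
  have h2 : ∑ i, F i j * F i j ≤ ∑ j, ∑ i, F i j * F i j :=
    Finset.single_le_sum (f := fun j => ∑ i, F i j * F i j)
      (fun _ _ => Finset.sum_nonneg fun _ _ => mul_self_nonneg _) (Finset.mem_univ j)
  exact abs_le.1 (abs_le_one_iff_mul_self_le_one.2 (h1.trans (h2.trans hsum.le)))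

/-- **Strict Kalman–Yakubovich–Popov lemma**: the frequency domain inequality implies that the
dissipation inequality has a solution `g`, a linear functional on matrices that stands for
`N ↦ tr (X N)`. -/
theorem exists_storage {α β : Type*} [Fintype α] [Fintype β]
    (L E : Matrix α β ℝ) (Q : Matrix β β ℝ)
    (hQ : ∀ v : β → ℂ, v ≠ 0 →
      (toC E *ᵥ v = 0 ∨ ∃ ω : ℝ, toC L *ᵥ v = (Complex.I * (ω : ℂ)) • toC E *ᵥ v) →
      (star v ⬝ᵥ toC Q *ᵥ v).re < 0) :
    ∃ (g : Matrix α α ℝ →ₗ[ℝ] ℝ) (ε : ℝ), 0 < ε ∧ ∀ v : β → ℝ,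
      g (vecMulVec (L *ᵥ v) (E *ᵥ v) + vecMulVec (E *ᵥ v) (L *ᵥ v)) + v ⬝ᵥ Q *ᵥ v
        ≤ -ε * (v ⬝ᵥ v) := by
  let Λ : Matrix β β ℝ →ₗ[ℝ] Matrix α α ℝ × ℝ :=
    { toFun := fun W => (L * W * Eᵀ + E * W * Lᵀ, trace (Q * W))
      map_add' := fun W Z => by
        ext <;> simp [Matrix.mul_add, Matrix.add_mul]; ring
      map_smul' := fun c W => by
        ext <;> simp }
  have hΛ : Continuous Λ := by
    change Continuous fun W => (L * W * Eᵀ + E * W * Lᵀ, trace (Q * W))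
    fun_prop
  have : LocallyConvexSpace ℝ (Matrix α α ℝ) :=
    inferInstanceAs (LocallyConvexSpace ℝ (α → α → ℝ))
  have hdisj : Disjoint (Λ '' spectraplex β) ({0} ×ˢ Ici (0 : ℝ)) := by
    rw [Set.disjoint_left]
    rintro _ ⟨W, ⟨hW, hW1⟩, rfl⟩ ⟨h0, h1⟩
    obtain ⟨F, rfl⟩ := exists_transpose_mul_self_of_posSemidef hW
    have hF : Fᵀ ≠ 0 := by
      intro hF
      simp [hF] at hW1
    have h2 := trace_neg_of_mul_transpose_add L E Q hQ Fᵀ hF (by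
      have h0 : L * (Fᵀ * F) * Eᵀ + E * (Fᵀ * F) * Lᵀ = 0 := h0
      rw [← h0]
      simp [Matrix.mul_assoc])
    have h3 : 0 ≤ trace (Q * (Fᵀ * F)) := h1
    rw [transpose_transpose, Matrix.mul_assoc, trace_mul_comm, Matrix.mul_assoc] at h2
    exact absurd h2 (not_lt.2 h3)
  obtain ⟨f, u, r, hu, hur, hr⟩ := geometric_hahn_banach_compact_closed
    ((convex_spectraplex β).linear_image Λ) ((isCompact_spectraplex β).image hΛ)
    ((convex_singleton 0).prod (convex_Ici 0)) (isClosed_singleton.prod isClosed_Ici) hdisj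
  set τ := f (0, 1) with hτ
  have hsplit : ∀ (N : Matrix α α ℝ) (c : ℝ), f (N, c) = f (N, 0) + c * τ := by
    intro N c
    rw [hτ, ← smul_eq_mul, ← map_smul, ← map_add]
    simp
  have hr0 : r < 0 := by
    have := hr (0, 0) (by simp)
    rwa [show ((0, 0) : Matrix α α ℝ × ℝ) = 0 from rfl, map_zero] at this
  -- With τ < 0 the point (0, r/τ) of the closed cone would take the value r, which separation
  -- excludes.
  have hτ0 : 0 ≤ τ := by
    by_contra! hneg
    have h1 := hr (0, r / τ) ⟨rfl, (div_pos_of_neg_of_neg hr0 hneg).le⟩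
    rw [hsplit, div_mul_cancel₀ _ hneg.ne, show ((0, 0) : Matrix α α ℝ × ℝ) = 0 from rfl,
      map_zero, zero_add] at h1
    exact lt_irrefl _ h1
  obtain ⟨c, hc⟩ := (isCompact_spectraplex β).exists_bound_of_continuousOn
    (f := fun W => trace (Q * W)) (by fun_prop)
  set d := max c 0 + 1 with hd
  have hd0 : 0 < d := by positivity
  have hu0 : u < 0 := hur.trans hr0
  -- τ may vanish, yet the inequality is to be divided by it. As tr(QW) ≤ d, raising τ by -u/(2d)
  -- costs at most -u/2, half of the separation margin.
  set σ := τ + -u / (2 * d) with hσ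
  have hδ : 0 < -u / (2 * d) := div_pos (neg_pos.2 hu0) (by positivity)
  have hσ0 : 0 < σ := by positivity
  have hbound : ∀ W ∈ spectraplex β,
      f (L * W * Eᵀ + E * W * Lᵀ, 0) + σ * trace (Q * W) ≤ u / 2 := by
    intro W hW
    have h1 : f (L * W * Eᵀ + E * W * Lᵀ, trace (Q * W)) < u := hu _ ⟨W, hW, rfl⟩
    rw [hsplit] at h1
    have h2 : trace (Q * W) ≤ d := by
      have := (le_abs_self _).trans (hc W hW)
      have := le_max_left c 0
      linarith
    have h3 : -u / (2 * d) * trace (Q * W) ≤ -u / (2 * d) * d :=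
      mul_le_mul_of_nonneg_left h2 hδ.le
    have h4 : -u / (2 * d) * d = -u / 2 := by field_simp
    rw [hσ, add_mul]
    linarith
  refine ⟨σ⁻¹ • (f.toLinearMap ∘ₗ LinearMap.inl ℝ _ _), σ⁻¹ * (-u / 2),
    mul_pos (inv_pos.2 hσ0) (by linarith), fun v => ?_⟩
  rcases eq_or_ne v 0 with rfl | hv
  · simp [show ((0, 0) : Matrix α α ℝ × ℝ) = 0 from rfl]
  set s := v ⬝ᵥ v with hs
  have hs0 : 0 < s := by
    have := dotProduct_star_self_pos_iff.2 hv
    simpa using this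
  -- Normalised rank-one matrices turn the bound on the spectraplex into a pointwise inequality in
  -- v.
  have hmem : s⁻¹ • vecMulVec v v ∈ spectraplex β := by
    refine ⟨PosSemidef.smul ?_ (inv_pos.2 hs0).le, ?_⟩
    · simpa using posSemidef_vecMulVec_self_star v
    · rw [trace_smul, trace_vecMulVec, smul_eq_mul, inv_mul_cancel₀ hs0.ne']
  have h1 := hbound _ hmem
  have h2 : L * (s⁻¹ • vecMulVec v v) * Eᵀ + E * (s⁻¹ • vecMulVec v v) * Lᵀ =
      s⁻¹ • (vecMulVec (L *ᵥ v) (E *ᵥ v) + vecMulVec (E *ᵥ v) (L *ᵥ v)) := by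
    simp only [Matrix.mul_smul, Matrix.smul_mul, mul_vecMulVec, vecMulVec_mul, vecMul_transpose,
      smul_add]
  have h3 : trace (Q * (s⁻¹ • vecMulVec v v)) = s⁻¹ * (v ⬝ᵥ Q *ᵥ v) := by
    rw [Matrix.mul_smul, trace_smul, mul_vecMulVec, trace_vecMulVec, smul_eq_mul, dotProduct_comm]
  set N := vecMulVec (L *ᵥ v) (E *ᵥ v) + vecMulVec (E *ᵥ v) (L *ᵥ v) with hN
  have h4 : f (s⁻¹ • N, 0) = s⁻¹ * f (N, 0) := by
    rw [← smul_eq_mul, ← map_smul]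
    simp
  rw [h2, h3, h4] at h1
  have h5 : f (N, 0) + σ * (v ⬝ᵥ Q *ᵥ v) ≤ u / 2 * s := by
    have := mul_le_mul_of_nonneg_left h1 hs0.le
    field_simp at this
    linarith
  have h6 := mul_le_mul_of_nonneg_left h5 (inv_pos.2 hσ0).le
  have h7 : σ⁻¹ * (f (N, 0) + σ * (v ⬝ᵥ Q *ᵥ v)) = σ⁻¹ * f (N, 0) + v ⬝ᵥ Q *ᵥ v := by
    field_simp
  rw [h7] at h6
  change σ⁻¹ * f (N, 0) + v ⬝ᵥ Q *ᵥ v ≤ _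
  linarith

/-! ### Signals and integrated dissipation -/

/-- One-sided limits bound the signal near each point, and compactness of the interval makes the
bound uniform. -/
theorem IsSignal.exists_norm_le {d : ℕ} {u : ℝ → Vec d} (hu : IsSignal u) (T : ℝ) :
    ∃ c : ℝ, ∀ t ∈ Icc 0 T, ‖u t‖ ≤ c := by
  refine isCompact_Icc.induction_on (p := fun s => ∃ c : ℝ, ∀ t ∈ s, ‖u t‖ ≤ c) ⟨0, by simp⟩
    (fun s t hst ⟨c, hc⟩ => ⟨c, fun r hr => hc r (hst hr)⟩)
    (fun s t ⟨c, hc⟩ ⟨c', hc'⟩ => ⟨max c c', fun r hr => hr.elim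
      (fun h => (hc r h).trans (le_max_left _ _)) fun h => (hc' r h).trans (le_max_right _ _)⟩) ?_
  intro t ht
  have hbdd : ∀ (l : Filter ℝ) (y : Vec d), Tendsto u l (𝓝 y) → ∀ᶠ r in l, ‖u r‖ ≤ ‖y‖ + 1 :=
    fun l y hl => (hl.norm.eventually_lt_const (lt_add_one _)).mono fun r hr => hr.le
  have hR : ∀ᶠ r in 𝓝[≥] t, ‖u r‖ ≤ ‖u t‖ + 1 := hbdd _ _ (hu.rightCont t ht.1)
  have hL : ∃ c : ℝ, ∀ᶠ r in 𝓝[Icc 0 T ∩ Iio t] t, ‖u r‖ ≤ c := by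
    rcases ht.1.eq_or_lt with h0 | h0
    · refine ⟨0, ?_⟩
      have : Icc 0 T ∩ Iio t = ∅ := by
        ext r; simp only [mem_inter_iff, mem_Icc, mem_Iio, mem_empty_iff_false, iff_false]
        intro h; linarith [h.1.1, h.2]
      simp [this]
    · obtain ⟨y, hy⟩ := hu.leftLim t h0
      exact ⟨_, (hbdd _ _ hy).filter_mono (nhdsWithin_mono _ inter_subset_right)⟩
  obtain ⟨c, hc⟩ := hL
  refine ⟨{r | ‖u r‖ ≤ max c (‖u t‖ + 1)}, ?_, max c (‖u t‖ + 1), fun r hr => hr⟩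
  have hsub : 𝓝[Icc 0 T] t ≤ 𝓝[Icc 0 T ∩ Iio t] t ⊔ 𝓝[≥] t := by
    rw [← nhdsWithin_union]
    refine nhdsWithin_mono _ fun r hr => ?_
    rcases lt_or_ge r t with h | h
    · exact Or.inl ⟨hr, h⟩
    · exact Or.inr h
  refine hsub (mem_sup.2 ⟨?_, ?_⟩)
  · exact hc.mono fun r hr => hr.trans (le_max_left _ _)
  · exact hR.mono fun r hr => hr.trans (le_max_right _ _)

theorem IsSignal.integrableOn_norm_sq {d : ℕ} {u : ℝ → Vec d} (hu : IsSignal u) (T : ℝ) :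
    IntegrableOn (fun t => ‖u t‖ ^ 2) (Icc 0 T) := by
  obtain ⟨c, hc⟩ := hu.exists_norm_le T
  have hmeas : AEStronglyMeasurable u (volume.restrict (Icc 0 T)) := by
    set F := {t : ℝ | t ∈ Ioc 0 T ∧ ¬ ContinuousAt u t}
    have hF : F.Finite := hu.finite_discont T
    have h1 : ContinuousOn u (Ioc 0 T \ F) := fun t ht => by
      have : ContinuousAt u t := by
        by_contra h
        exact ht.2 ⟨ht.1, h⟩
      exact this.continuousWithinAt
    have h2 := h1.aestronglyMeasurable (μ := volume) (measurableSet_Ioc.diff hF.measurableSet)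
    have h3 : (Ioc 0 T \ F : Set ℝ) =ᵐ[volume] Icc 0 T :=
      (sdiff_null_ae_eq_self (hF.measure_zero _)).trans Ioc_ae_eq_Icc
    rwa [Measure.restrict_congr_set h3] at h2
  refine Integrable.of_bound (hmeas.norm.pow 2) (c ^ 2) ?_
  refine (ae_restrict_iff' measurableSet_Icc).2 (Eventually.of_forall fun t ht => ?_)
  rw [Real.norm_of_nonneg (by positivity)]
  exact pow_le_pow_left₀ (norm_nonneg _) (hc t ht) 2

/-- The dissipation inequality for `V x = g (x xᵀ)`, integrated along a state trajectory. -/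
theorem integral_le_of_dissipation {n m : ℕ} {x v : ℝ → Vec n} {w : ℝ → Vec m}
    (hx : IsStateTrajectory x v) (hw : IsSignal w) (g : Matrix (Fin n) (Fin n) ℝ →ₗ[ℝ] ℝ) (ε : ℝ)
    (h : ∀ t, 0 ≤ t → g (vecMulVec (v t).ofLp (x t).ofLp + vecMulVec (x t).ofLp (v t).ofLp)
      ≤ -ε * (‖x t‖ ^ 2 + ‖w t‖ ^ 2)) {T : ℝ} (hT : 0 ≤ T) :
    g (vecMulVec (x T).ofLp (x T).ofLp) +
        ε * ((∫ t in (0 : ℝ)..T, ‖x t‖ ^ 2) + ∫ t in (0 : ℝ)..T, ‖w t‖ ^ 2)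
      ≤ g (vecMulVec (x 0).ofLp (x 0).ofLp) := by
  have hg : Continuous g := LinearMap.continuous_of_finiteDimensional g
  have hvec : Continuous fun p : Vec n => g (vecMulVec p.ofLp p.ofLp) := by fun_prop
  have hxi : IntegrableOn (fun t => ‖x t‖ ^ 2) (Icc 0 T) :=
    ((hx.cont.mono Icc_subset_Ici_self).norm.pow 2).integrableOn_Icc
  have hwi := hw.integrableOn_norm_sq T
  have hderiv : ∀ t ∈ Ioo 0 T, HasDerivWithinAt (fun s => g (vecMulVec (x s).ofLp (x s).ofLp))
      (g (vecMulVec (v t).ofLp (x t).ofLp + vecMulVec (x t).ofLp (v t).ofLp)) (Ioi t) t := by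
    intro t ht
    have h1 := (hx.hasRightDeriv t ht.1.le).mono Ioi_subset_Ici_self
    have h2 : ∀ i, HasDerivWithinAt (fun s => x s i) (v t i) (Ioi t) t := fun i =>
      (EuclideanSpace.proj (𝕜 := ℝ) i).hasFDerivAt.comp_hasDerivWithinAt t h1
    have h3 : HasDerivWithinAt (fun s => (fun i j => x s i * x s j : Fin n → Fin n → ℝ))
        (fun i j => v t i * x t j + x t i * v t j) (Ioi t) t :=
      hasDerivWithinAt_pi.2 fun i => hasDerivWithinAt_pi.2 fun j => (h2 i).mul (h2 j)
    let g' : (Fin n → Fin n → ℝ) →L[ℝ] ℝ := ⟨g, hg⟩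
    exact g'.hasFDerivAt.comp_hasDerivWithinAt t h3
  -- This comparison needs only a right derivative and an integrable upper bound for it, so jumps of
  -- w do no harm.
  have key := intervalIntegral.sub_le_integral_of_hasDeriv_right_of_le hT
    (hvec.comp_continuousOn (hx.cont.mono Icc_subset_Ici_self)) hderiv
    ((hxi.add hwi).const_mul (-ε)) (fun t ht => h t ht.1.le)
  rw [← intervalIntegrable_iff_integrableOn_Icc_of_le hT] at hxi hwi
  simp only [Pi.add_apply, Function.comp] at key
  rw [intervalIntegral.integral_const_mul, intervalIntegral.integral_add hxi hwi] at key
  linarith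

/-! ### From the frequency inequality to a storage function -/

theorem dotProduct_quadMatrix_mulVec {𝕜 : Type*} [RCLike 𝕜] {k m p : ℕ}
    (P : Matrix (Fin k ⊕ Fin m) (Fin k ⊕ Fin m) 𝕜) (U : Matrix (Fin m) (Fin p) 𝕜)
    (Y : Matrix (Fin k) (Fin p) 𝕜) (v : Fin p → 𝕜) :
    star v ⬝ᵥ quadMatrix P U Y *ᵥ v =
      star (Sum.elim (Y *ᵥ v) (U *ᵥ v)) ⬝ᵥ P *ᵥ Sum.elim (Y *ᵥ v) (U *ᵥ v) := by
  rw [quadMatrix, ← mulVec_mulVec, ← mulVec_mulVec, dotProduct_mulVec, ← star_mulVec,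
    fromRows_mulVec]

variable {n m k : ℕ}

/-- The matrix mapping `(x, w)` to `(C x + D w, w)`. -/
def LinSys.outputInput (S : LinSys n m k) : Matrix (Fin k ⊕ Fin m) (Fin n ⊕ Fin m) ℝ :=
  fromRows (fromCols S.C S.D) (fromCols 0 1)

theorem toC_fromCols {α β γ : Type*} (M : Matrix α β ℝ) (N : Matrix α γ ℝ) :
    toC (fromCols M N) = fromCols (toC M) (toC N) := by
  ext i (j | j) <;> rfl

theorem toC_fromRows {α β γ : Type*} (M : Matrix α γ ℝ) (N : Matrix β γ ℝ) :
    toC (fromRows M N) = fromRows (toC M) (toC N) := by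
  ext (i | i) j <;> rfl

theorem toC_one {α : Type*} [DecidableEq α] : toC (1 : Matrix α α ℝ) = 1 :=
  Matrix.map_one _ Complex.ofReal_zero Complex.ofReal_one

theorem toC_zero {α β : Type*} : toC (0 : Matrix α β ℝ) = 0 :=
  Matrix.map_zero _ Complex.ofReal_zero

theorem LinSys.toC_outputInput_mulVec (S : LinSys n m k) (x : Fin n → ℂ) (u : Fin m → ℂ) :
    toC S.outputInput *ᵥ Sum.elim x u = Sum.elim (toC S.C *ᵥ x + toC S.D *ᵥ u) u := by
  rw [LinSys.outputInput, toC_fromRows, toC_fromCols, toC_fromCols, toC_one, toC_zero,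
    fromRows_mulVec, fromCols_mulVec_sumElim, fromCols_mulVec_sumElim, zero_mulVec, one_mulVec,
    zero_add]

theorem LinSys.outputInput_mulVec (S : LinSys n m k) (x : Fin n → ℝ) (u : Fin m → ℝ) :
    S.outputInput *ᵥ Sum.elim x u = Sum.elim (S.C *ᵥ x + S.D *ᵥ u) u := by
  rw [LinSys.outputInput, fromRows_mulVec, fromCols_mulVec_sumElim, fromCols_mulVec_sumElim,
    zero_mulVec, one_mulVec, zero_add]

theorem LinSys.NoImaginaryEigenvalue.isUnit_det {S : LinSys n m k} (hA : S.NoImaginaryEigenvalue)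
    (ω : ℝ) : IsUnit (((Complex.I * (ω : ℂ)) • (1 : Matrix (Fin n) (Fin n) ℂ) - toC S.A).det) := by
  rw [isUnit_iff_ne_zero]
  intro h
  obtain ⟨v, hv, hv0⟩ := exists_mulVec_eq_zero_iff.2 h
  refine hA ω (Module.End.hasEigenvalue_of_hasEigenvector (x := v)
    (Module.End.hasEigenvector_iff.2 ⟨Module.End.mem_eigenspace_iff.2 ?_, hv⟩))
  rw [sub_mulVec, smul_mulVec, one_mulVec, sub_eq_zero] at hv0
  exact hv0.symm

theorem StrictFDI.re_neg {S : LinSys n m k} {P : Matrix (Fin k ⊕ Fin m) (Fin k ⊕ Fin m) ℝ}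
    (hFDI : StrictFDI S P) (ω : OnePoint ℝ) {u : Fin m → ℂ} (hu : u ≠ 0) :
    (star (Sum.elim (S.freqResponse ω *ᵥ u) u) ⬝ᵥ
      toC P *ᵥ Sum.elim (S.freqResponse ω *ᵥ u) u).re < 0 := by
  have h := (hFDI ω).dotProduct_mulVec_pos hu
  rw [neg_mulVec, dotProduct_neg, dotProduct_quadMatrix_mulVec, one_mulVec] at h
  have := (Complex.lt_def.1 h).1
  simpa using this

/-- For v = (x, u), the first alternative is x = 0, the case ω = ∞; the second is x = (iω - A)⁻¹Bu,
so the output is G(iω)u. In both cases u = 0 would force v = 0. -/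
theorem StrictFDI.re_form_neg {S : LinSys n m k} {P : Matrix (Fin k ⊕ Fin m) (Fin k ⊕ Fin m) ℝ}
    (hA : S.NoImaginaryEigenvalue) (hFDI : StrictFDI S P) (v : Fin n ⊕ Fin m → ℂ) (hv : v ≠ 0)
    (h : toC (fromCols 1 0 : Matrix (Fin n) (Fin n ⊕ Fin m) ℝ) *ᵥ v = 0 ∨
      ∃ ω : ℝ, toC (fromCols S.A S.B) *ᵥ v =
        (Complex.I * (ω : ℂ)) • toC (fromCols 1 0 : Matrix (Fin n) (Fin n ⊕ Fin m) ℝ) *ᵥ v) :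
    (star v ⬝ᵥ toC (S.outputInputᵀ * P * S.outputInput) *ᵥ v).re < 0 := by
  obtain ⟨x, u, rfl⟩ : ∃ x u, v = Sum.elim x u := ⟨_, _, (Sum.elim_comp_inl_inr v).symm⟩
  have hform : star (Sum.elim x u) ⬝ᵥ toC (S.outputInputᵀ * P * S.outputInput) *ᵥ Sum.elim x u =
      star (Sum.elim (toC S.C *ᵥ x + toC S.D *ᵥ u) u) ⬝ᵥ
        toC P *ᵥ Sum.elim (toC S.C *ᵥ x + toC S.D *ᵥ u) u := by
    rw [toC_mul, toC_mul, toC_transpose, ← mulVec_mulVec, ← mulVec_mulVec, dotProduct_mulVec,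
      ← star_mulVec, S.toC_outputInput_mulVec]
  rw [hform]
  simp only [toC_fromCols, toC_one, toC_zero, fromCols_mulVec_sumElim, one_mulVec, zero_mulVec,
    add_zero] at h
  rcases h with rfl | ⟨ω, h⟩
  · have hu : u ≠ 0 := by
      rintro rfl
      exact hv (by ext (i | i) <;> rfl)
    have := hFDI.re_neg OnePoint.infty hu
    rw [mulVec_zero, zero_add]
    exact this
  · have hdet := hA.isUnit_det ω
    set M := (Complex.I * (ω : ℂ)) • (1 : Matrix (Fin n) (Fin n) ℂ) - toC S.A with hM
    have h1 : M *ᵥ x = toC S.B *ᵥ u := by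
      rw [hM, sub_mulVec, smul_mulVec, one_mulVec, ← h, add_sub_cancel_left]
    have h2 : x = M⁻¹ *ᵥ (toC S.B *ᵥ u) := by
      rw [← h1, mulVec_mulVec, nonsing_inv_mul _ hdet, one_mulVec]
    have hu : u ≠ 0 := by
      rintro rfl
      refine hv ?_
      rw [h2, mulVec_zero, mulVec_zero]
      ext (i | i) <;> rfl
    have h3 : toC S.C *ᵥ x + toC S.D *ᵥ u = S.freqResponse (OnePoint.some ω) *ᵥ u := by
      change _ = (toC S.C * M⁻¹ * toC S.B + toC S.D) *ᵥ u
      rw [add_mulVec, ← mulVec_mulVec, ← mulVec_mulVec, ← h2]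
    rw [h3]
    exact hFDI.re_neg _ hu

/-- The dissipation inequality for the linear system with supply rate `-quadVec P`. -/
theorem StrictFDI.exists_storage {S : LinSys n m k} {P : Matrix (Fin k ⊕ Fin m) (Fin k ⊕ Fin m) ℝ}
    (hA : S.NoImaginaryEigenvalue) (hFDI : StrictFDI S P) :
    ∃ (g : Matrix (Fin n) (Fin n) ℝ →ₗ[ℝ] ℝ) (ε : ℝ), 0 < ε ∧ ∀ (x v : Vec n) (w : Vec m) (z : Vec k),
      v = toEuclideanLin S.A x + toEuclideanLin S.B w →
      z = toEuclideanLin S.C x + toEuclideanLin S.D w →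
      g (vecMulVec v.ofLp x.ofLp + vecMulVec x.ofLp v.ofLp) + quadVec P w z
        ≤ -ε * (‖x‖ ^ 2 + ‖w‖ ^ 2) := by
  obtain ⟨g, ε, hε, h⟩ := CircleCriterion.exists_storage (fromCols S.A S.B) (fromCols 1 0)
    (S.outputInputᵀ * P * S.outputInput) (hFDI.re_form_neg hA)
  refine ⟨g, ε, hε, ?_⟩
  rintro x v w z rfl rfl
  have h1 := h (Sum.elim x.ofLp w.ofLp)
  rw [← mulVec_mulVec, ← mulVec_mulVec, dotProduct_mulVec _ S.outputInputᵀ, vecMul_transpose,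
    S.outputInput_mulVec, fromCols_mulVec_sumElim, fromCols_mulVec_sumElim, one_mulVec,
    zero_mulVec, add_zero] at h1
  have h2 : Sum.elim x.ofLp w.ofLp ⬝ᵥ Sum.elim x.ofLp w.ofLp = ‖x‖ ^ 2 + ‖w‖ ^ 2 := by
    simp [dotProduct, EuclideanSpace.real_norm_sq_eq, ← sq]
  rw [h2] at h1
  exact h1

theorem IsResponse.integral_le {S : LinSys n m k} {P : Matrix (Fin k ⊕ Fin m) (Fin k ⊕ Fin m) ℝ}
    {g : Matrix (Fin n) (Fin n) ℝ →ₗ[ℝ] ℝ} {ε : ℝ}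
    (hg : ∀ (x v : Vec n) (w : Vec m) (z : Vec k),
      v = toEuclideanLin S.A x + toEuclideanLin S.B w →
      z = toEuclideanLin S.C x + toEuclideanLin S.D w →
      g (vecMulVec v.ofLp x.ofLp + vecMulVec x.ofLp v.ofLp) + quadVec P w z
        ≤ -ε * (‖x‖ ^ 2 + ‖w‖ ^ 2))
    {φ : Nonlinearity k m} (hφ : QuadraticConstraint P φ) {x₀ : Vec n} {x : ℝ → Vec n}
    {w : ℝ → Vec m} {z : ℝ → Vec k} (h : IsResponse S φ x₀ x w z) {T : ℝ} (hT : 0 ≤ T) :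
    g (vecMulVec (x T).ofLp (x T).ofLp) +
        ε * ((∫ t in (0 : ℝ)..T, ‖x t‖ ^ 2) + ∫ t in (0 : ℝ)..T, ‖w t‖ ^ 2)
      ≤ g (vecMulVec x₀.ofLp x₀.ofLp) := by
  obtain ⟨v, hx, hv⟩ := h.dynamics
  rw [← h.init]
  refine integral_le_of_dissipation hx h.signal_w g ε (fun t ht => ?_) hT
  have h1 := hg _ _ _ _ (hv t ht) (h.output t ht)
  have h2 := hφ _ _ (h.feedback t ht)
  linarith

/-! ### The nominal linear loop -/

theorem quadraticConstraint_linearNonlinearity {P : Matrix (Fin k ⊕ Fin m) (Fin k ⊕ Fin m) ℝ}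
    {Δ : Matrix (Fin m) (Fin k) ℝ} (h : (quadMatrix P Δ 1).PosSemidef) :
    QuadraticConstraint P (linearNonlinearity Δ) := by
  rintro z w rfl
  have h1 := h.dotProduct_mulVec_nonneg z.ofLp
  rw [dotProduct_quadMatrix_mulVec, one_mulVec, star_trivial] at h1
  exact h1

theorem IsSignal.of_continuous {d : ℕ} {u : ℝ → Vec d} (hu : Continuous u) : IsSignal u where
  rightCont t _ := hu.continuousWithinAt
  leftLim t _ := ⟨u t, hu.continuousAt.tendsto.mono_left nhdsWithin_le_nhds⟩
  finite_discont T := by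
    convert! Set.finite_empty
    ext t
    simp [hu.continuousAt]

/-- A well-posed loop with linear feedback has a response for each initial state. -/
theorem exists_isResponse_linearNonlinearity (S : LinSys n m k) (Δ : Matrix (Fin m) (Fin k) ℝ)
    (hdet : IsUnit (1 - Δ * S.D).det) (x₀ : Vec n) :
    ∃ x w z, IsResponse S (linearNonlinearity Δ) x₀ x w z := by
  -- The gain M solves the algebraic loop w = Δ(Cx + Dw) as w = Mx, leaving x' = (A + BM)x.
  set M : Matrix (Fin m) (Fin n) ℝ := (1 - Δ * S.D)⁻¹ * (Δ * S.C) with hM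
  have hM1 : M = Δ * S.C + Δ * S.D * M := by
    have : (1 - Δ * S.D) * M = Δ * S.C := by
      rw [hM, ← Matrix.mul_assoc, mul_nonsing_inv _ hdet, Matrix.one_mul]
    rw [Matrix.sub_mul, Matrix.one_mul] at this
    exact sub_eq_iff_eq_add.1 this
  let a : Vec n →L[ℝ] Vec n := (toEuclideanLin (S.A + S.B * M)).toContinuousLinearMap
  let x : ℝ → Vec n := fun t => NormedSpace.exp (t • a) x₀
  have hderiv : ∀ t, HasDerivAt x (a (x t)) t := fun t =>
    ((hasDerivAt_exp_smul_const' (𝕂 := ℝ) a t).clm_apply (hasDerivAt_const t x₀)).congr_deriv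
      (by simp [x])
  have hxc : Continuous x := continuous_iff_continuousAt.2 fun t => (hderiv t).continuousAt
  have hlin : ∀ {p q : ℕ} (N : Matrix (Fin p) (Fin q) ℝ), Continuous (toEuclideanLin N) :=
    fun N => LinearMap.continuous_of_finiteDimensional _
  refine ⟨x, fun t => toEuclideanLin M (x t),
    fun t => toEuclideanLin S.C (x t) + toEuclideanLin S.D (toEuclideanLin M (x t)),
    IsSignal.of_continuous ((hlin _).comp hxc),
    IsSignal.of_continuous (((hlin _).comp hxc).add ((hlin _).comp ((hlin _).comp hxc))),
    ⟨fun t => a (x t), ⟨hxc.continuousOn, IsSignal.of_continuous (a.continuous.comp hxc),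
      fun t _ => (hderiv t).hasDerivWithinAt⟩, fun t _ => ?_⟩, fun t _ => rfl, fun t _ => ?_, ?_⟩
  · change toEuclideanLin (S.A + S.B * M) (x t) = _
    rw [map_add, LinearMap.add_apply, toEuclideanLin, toLpLin_mul_same, LinearMap.comp_apply]
  · change toEuclideanLin M (x t) = toEuclideanLin Δ _
    conv_lhs => rw [hM1]
    simp only [toEuclideanLin, map_add, LinearMap.add_apply, toLpLin_mul_same,
      LinearMap.comp_apply]
  · have h0 : (0 : ℝ) • a = 0 := zero_smul ℝ a
    change NormedSpace.exp ((0 : ℝ) • a) x₀ = x₀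
    rw [h0, NormedSpace.exp_zero, one_apply_eq_self]

/-- A kernel vector u = ΔDu puts (Du, u) on the graph of Δ, where the form is nonnegative, although
it is negative at (Du, u). -/
theorem isUnit_det_of_quadVec_neg {P : Matrix (Fin k ⊕ Fin m) (Fin k ⊕ Fin m) ℝ}
    {Δ : Matrix (Fin m) (Fin k) ℝ} {D : Matrix (Fin k) (Fin m) ℝ}
    (hΔ : QuadraticConstraint P (linearNonlinearity Δ))
    (hD : ∀ w : Vec m, w ≠ 0 → quadVec P w (toEuclideanLin D w) < 0) :
    IsUnit (1 - Δ * D).det := by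
  rw [isUnit_iff_ne_zero]
  intro h
  obtain ⟨u, hu, hu0⟩ := exists_mulVec_eq_zero_iff.2 h
  rw [sub_mulVec, one_mulVec, sub_eq_zero] at hu0
  have h1 : WithLp.toLp 2 u ∈ linearNonlinearity Δ (toEuclideanLin D (WithLp.toLp 2 u)) := by
    change WithLp.toLp 2 u = toEuclideanLin Δ (toEuclideanLin D (WithLp.toLp 2 u))
    rw [← LinearMap.comp_apply, ← toLpLin_mul_same, toLpLin_toLp, toLin'_apply, ← hu0]
  have h2 : WithLp.toLp 2 u ≠ 0 := by simpa using hu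
  exact absurd (hD _ h2) (not_lt.2 (hΔ _ _ h1))

theorem exists_abs_apply_vecMulVec_le (g : Matrix (Fin n) (Fin n) ℝ →ₗ[ℝ] ℝ) :
    ∃ c : ℝ, 0 < c ∧ ∀ x : Vec n, |g (vecMulVec x.ofLp x.ofLp)| ≤ c * ‖x‖ ^ 2 := by
  let g' : (Fin n → Fin n → ℝ) →L[ℝ] ℝ := ⟨g, LinearMap.continuous_of_finiteDimensional g⟩
  refine ⟨‖g'‖ + 1, by positivity, fun x => ?_⟩
  have h1 : ‖(fun i j => x i * x j : Fin n → Fin n → ℝ)‖ ≤ ‖x‖ ^ 2 := by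
    refine (pi_norm_le_iff_of_nonneg (by positivity)).2 fun i =>
      (pi_norm_le_iff_of_nonneg (by positivity)).2 fun j => ?_
    rw [norm_mul, sq]
    exact mul_le_mul (PiLp.norm_apply_le x i) (PiLp.norm_apply_le x j) (norm_nonneg _)
      (norm_nonneg _)
  have h2 := g'.le_of_opNorm_le_of_le (le_add_of_nonneg_right zero_le_one) h1
  exact h2

end CircleCriterion

/-! ### The circle criterion -/

open CircleCriterion Matrix in
theorem mainTheorem5 (n m k : ℕ) (S : CircleCriterion.LinSys n m k)
    (P : Matrix (Fin k ⊕ Fin m) (Fin k ⊕ Fin m) ℝ) (hP : P.IsSymm)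
    (hA : S.NoImaginaryEigenvalue)
    (hnom : ∃ Δ₀ : Matrix (Fin m) (Fin k) ℝ,
      (CircleCriterion.quadMatrix P Δ₀ 1).PosSemidef ∧
      CircleCriterion.LoopAttractive S (CircleCriterion.linearNonlinearity Δ₀))
    (hFDI : CircleCriterion.StrictFDI S P) :
    ∀ φ : CircleCriterion.Nonlinearity k m,
      CircleCriterion.QuadraticConstraint P φ → CircleCriterion.LoopStable S φ := by
  intro φ hφ
  obtain ⟨Δ, hΔ, hattr⟩ := hnom
  replace hΔ := quadraticConstraint_linearNonlinearity hΔ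
  obtain ⟨g, ε, hε, hg⟩ := hFDI.exists_storage hA
  have hdet : IsUnit (1 - Δ * S.D).det := by
    refine isUnit_det_of_quadVec_neg hΔ fun w hw => ?_
    -- At x = 0 the storage term drops out, leaving s_P(w, Dw) ≤ -ε‖w‖².
    have h1 := hg 0 _ w _ rfl rfl
    rw [map_zero, zero_add, WithLp.ofLp_zero, vecMulVec_zero, zero_vecMulVec, add_zero, map_zero,
      zero_add] at h1
    rw [map_zero, zero_add, norm_zero] at h1
    have h2 : 0 < ε * ‖w‖ ^ 2 := by
      have := norm_pos_iff.2 hw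
      positivity
    linarith
  have hnonneg : ∀ x₀ : Vec n, 0 ≤ g (vecMulVec x₀.ofLp x₀.ofLp) := by
    intro x₀
    obtain ⟨x, w, z, hr⟩ := exists_isResponse_linearNonlinearity S Δ hdet x₀
    have hcont : Continuous fun p : Vec n => g (vecMulVec p.ofLp p.ofLp) := by
      have := LinearMap.continuous_of_finiteDimensional g
      fun_prop
    have hlim := (hcont.tendsto 0).comp (hattr x₀ x w z hr)
    rw [WithLp.ofLp_zero, vecMulVec_zero, map_zero] at hlim
    refine le_of_tendsto hlim ((eventually_ge_atTop 0).mono fun T hT => ?_)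
    have h1 := hr.integral_le hg hΔ hT
    have h2 : 0 ≤ ∫ t in (0 : ℝ)..T, ‖x t‖ ^ 2 :=
      intervalIntegral.integral_nonneg hT fun t _ => by positivity
    have h3 : 0 ≤ ∫ t in (0 : ℝ)..T, ‖w t‖ ^ 2 :=
      intervalIntegral.integral_nonneg hT fun t _ => by positivity
    have h4 := mul_nonneg hε.le (add_nonneg h2 h3)
    simp only [Function.comp]
    linarith
  obtain ⟨c, hc, hgc⟩ := exists_abs_apply_vecMulVec_le g
  -- From ε∫(‖x‖² + ‖w‖²) ≤ V(x₀) ≤ c‖x₀‖², after discarding V(x(T)) ≥ 0.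
  refine ⟨√(c / ε), Real.sqrt_pos.2 (div_pos hc hε), fun x₀ x w z hr T hT => ?_⟩
  rw [Real.sq_sqrt (div_pos hc hε).le, div_mul_eq_mul_div, le_div_iff₀ hε]
  have h1 := hr.integral_le hg hφ hT
  have h2 := hnonneg (x T)
  have h3 := (le_abs_self _).trans (hgc x₀)
  linarith
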